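/- Let $E$ be a (real) Banach lattice, $Y$ a (real) Banach space, $T:E\to Y$ a bounded linear operator, and $u\in E^{+}=\{x\in E: x\ge 0\}$. Let $E'$ be the topological dual of $E$ and $(E')^{+}=\{g\in E' : g(y)\ge 0 \text{ for all } y\in E^{+}\}$. A sequence $(x_n)$ in $E$ is called uaw-null (unbounded absolutely weakly null) if $|x_n|\wedge v\to 0$ weakly for every $v\in E^{+}$. For a norm bounded set $S\subseteq E$ with solid hull $\mathrm{sol}(S)=\{x\in E:\exists y\in S,\ |x|\le |y|\}$, the operator $T$ is called $S$-L-weakly compact if $\|T x_n\|\to 0$ for every uaw-null sequence $(x_n)$ contained in $\mathrm{sol}(S)$. Then the following are equivalent: 1. $T$ is $[-u,u]$-L-weakly compact, where $[-u,u]=\{x\in E:-u\le x\le u\}$; 2. for every $\varepsilon>0$ there exists $g\in (E')^{+}$ such that $\|Tx\|\le g(|x|)+\varepsilon$ for all $x\in[-u,u]$. -/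

import Mathlib

open Filter Topology

/-- A family `x` converges to `a` along the filter `l` in the unbounded absolute weak (uaw) sense:
for every `u ≥ 0` the family `|x i - a| ⊓ u` converges to `0` in the weak topology of `E`. -/
def UAWTendsto {E : Type*} [NormedAddCommGroup E] [NormedSpace ℝ E] [Lattice E]
    {ι : Type*} (x : ι → E) (l : Filter ι) (a : E) : Prop :=
  ∀ u : E, 0 ≤ u → Tendsto (fun i => toWeakSpace ℝ E (|x i - a| ⊓ u)) l (𝓝 0)

/-- The operator `T` is `S`-L-weakly compact: it maps every uaw-null sequence of the solid hull
of `S` to a norm-null sequence. The notion is used for norm bounded sets `S` only. -/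
def IsLWeaklyCompactOn {E Y : Type*} [NormedAddCommGroup E] [NormedSpace ℝ E] [Lattice E]
    [NormedAddCommGroup Y] [NormedSpace ℝ Y] (T : E →L[ℝ] Y) (S : Set E) : Prop :=
  ∀ x : ℕ → E, (∀ n, x n ∈ LatticeOrderedAddCommGroup.solidClosure S) →
    UAWTendsto x atTop 0 → Tendsto (fun n => T (x n)) atTop (𝓝 0)

/-- Symmetric order intervals of a normed lattice are norm bounded, so that
`IsLWeaklyCompactOn T (Set.Icc (-u) u)` is meaningful. -/
theorem isBounded_Icc_neg_self {E : Type*} [NormedAddCommGroup E] [Lattice E] [HasSolidNorm E]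
    [IsOrderedAddMonoid E] (u : E) : Bornology.IsBounded (Set.Icc (-u) u) := by
  refine isBounded_iff_forall_norm_le.2 ⟨‖u‖, fun x hx => HasSolidNorm.solid ?_⟩
  exact (abs_le'.2 ⟨hx.2, neg_le.1 hx.1⟩).trans (le_abs_self u)

section RieszDecomposition

variable {E : Type*} [AddCommGroup E] [Lattice E] [IsOrderedAddMonoid E]

/-- Riesz decomposition: an element dominated by a sum of positive elements splits into parts
dominated by the summands. -/
theorem exists_add_eq_of_abs_le_add {x a b : E} (ha : 0 ≤ a) (hb : 0 ≤ b) (h : |x| ≤ a + b) :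
    ∃ x₁ x₂ : E, |x₁| ≤ a ∧ |x₂| ≤ b ∧ x₁ + x₂ = x := by
  obtain ⟨h₁, h₂⟩ := abs_le'.1 h
  refine ⟨(x ⊓ a) ⊔ (-a), x - ((x ⊓ a) ⊔ (-a)), ?_, ?_, by abel⟩
  · refine abs_le'.2 ⟨sup_le inf_le_right ((neg_nonpos.2 ha).trans ha), ?_⟩
    exact neg_le.1 le_sup_right
  · refine abs_le'.2 ⟨?_, ?_⟩
    · refine (sub_le_sub_left le_sup_left x).trans ?_
      refine sub_le_comm.1 (le_inf (sub_le_self x hb) ?_)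
      exact sub_le_iff_le_add.2 h₁
    · rw [neg_sub]
      refine sub_le_iff_le_add.2 (sup_le ?_ ?_)
      · exact inf_le_left.trans (le_add_of_nonneg_left hb)
      · refine neg_le_iff_add_nonneg.2 ?_
        have : -x - (a + b) ≤ 0 := sub_nonpos.2 h₂
        have h₃ := neg_nonneg.2 this
        refine h₃.trans_eq (by abel)

theorem posPart_add_le (a b : E) : (a + b)⁺ ≤ a⁺ + b⁺ :=
  sup_le (add_le_add (le_posPart a) (le_posPart b)) (add_nonneg (posPart_nonneg a) (posPart_nonneg b))

end RieszDecomposition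

section LatticeSeminorm

variable {E Y : Type*} [NormedAddCommGroup E] [NormedSpace ℝ E] [Lattice E]
  [NormedAddCommGroup Y] [NormedSpace ℝ Y]

/-- The supremum of `‖T x‖` over the `x` dominated by the positive part of `z`. -/
noncomputable def posSupNorm (T : E →L[ℝ] Y) (z : E) : ℝ :=
  sSup ((fun x => ‖T x‖) '' {x | |x| ≤ z⁺})

variable (T : E →L[ℝ] Y)

theorem posSupNorm_nonneg (z : E) : 0 ≤ posSupNorm T z :=
  Real.sSup_nonneg (by rintro _ ⟨x, -, rfl⟩; exact norm_nonneg _)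

variable [IsOrderedAddMonoid E]

variable {T} in
theorem posSupNorm_le {z : E} {C : ℝ} (h : ∀ x, |x| ≤ z⁺ → ‖T x‖ ≤ C) : posSupNorm T z ≤ C :=
  csSup_le (Set.Nonempty.image _ ⟨0, by simp⟩)
    (by rintro _ ⟨x, hx, rfl⟩; exact h x hx)

variable {T} in
theorem exists_lt_norm_of_lt_posSupNorm {z : E} {δ : ℝ} (h : δ < posSupNorm T z) :
    ∃ x, |x| ≤ z⁺ ∧ δ < ‖T x‖ := by
  by_contra! H
  exact h.not_ge (posSupNorm_le H)

variable [HasSolidNorm E]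

theorem norm_apply_le_of_abs_le_posPart {x z : E} (h : |x| ≤ z⁺) : ‖T x‖ ≤ ‖T‖ * ‖z‖ := by
  refine (T.le_opNorm x).trans (mul_le_mul_of_nonneg_left ?_ (norm_nonneg T))
  refine norm_le_norm_of_abs_le_abs (h.trans ?_)
  exact sup_le (le_abs_self z) (abs_nonneg z)

theorem norm_le_posSupNorm {x z : E} (h : |x| ≤ z⁺) : ‖T x‖ ≤ posSupNorm T z := by
  refine le_csSup ⟨‖T‖ * ‖z‖, ?_⟩ ⟨x, h, rfl⟩
  rintro _ ⟨y, hy, rfl⟩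
  exact norm_apply_le_of_abs_le_posPart T hy

theorem posSupNorm_le_opNorm_mul (z : E) : posSupNorm T z ≤ ‖T‖ * ‖z‖ :=
  posSupNorm_le fun _ => norm_apply_le_of_abs_le_posPart T

theorem posSupNorm_mono : Monotone (posSupNorm T) := fun _ _ h =>
  posSupNorm_le fun _ hx => norm_le_posSupNorm T (hx.trans (posPart_mono h))

theorem posSupNorm_of_nonpos {z : E} (h : z ≤ 0) : posSupNorm T z = 0 := by
  refine le_antisymm (posSupNorm_le fun x hx => ?_) (posSupNorm_nonneg T z)
  rw [posPart_eq_zero.2 h] at hx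
  simpa using norm_apply_le_of_abs_le_posPart T (z := 0) (by simpa using hx)

theorem posSupNorm_le_add_of_posPart_le {a b c : E} (h : c⁺ ≤ a⁺ + b⁺) :
    posSupNorm T c ≤ posSupNorm T a + posSupNorm T b := by
  refine posSupNorm_le fun x hx => ?_
  obtain ⟨x₁, x₂, h₁, h₂, rfl⟩ :=
    exists_add_eq_of_abs_le_add (posPart_nonneg a) (posPart_nonneg b) (hx.trans h)
  rw [map_add]
  exact (norm_add_le _ _).trans (add_le_add (norm_le_posSupNorm T h₁) (norm_le_posSupNorm T h₂))

theorem posSupNorm_add_le (a b : E) :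
    posSupNorm T (a + b) ≤ posSupNorm T a + posSupNorm T b :=
  posSupNorm_le_add_of_posPart_le T (posPart_add_le a b)

theorem posSupNorm_sup_le (a b : E) :
    posSupNorm T (a ⊔ b) ≤ posSupNorm T a + posSupNorm T b := by
  refine posSupNorm_le_add_of_posPart_le T (sup_le (sup_le ?_ ?_) ?_)
  · exact (le_posPart a).trans (le_add_of_nonneg_right (posPart_nonneg b))
  · exact (le_posPart b).trans (le_add_of_nonneg_left (posPart_nonneg a))
  · exact add_nonneg (posPart_nonneg a) (posPart_nonneg b)

theorem nonneg_of_le_posSupNorm {φ : StrongDual ℝ E} (hφ : ∀ z, φ z ≤ posSupNorm T z) {y : E}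
    (hy : 0 ≤ y) : 0 ≤ φ y := by
  have h := (hφ (-y)).trans_eq (posSupNorm_of_nonpos T (neg_nonpos.2 hy))
  rwa [map_neg, neg_nonpos] at h

variable [IsOrderedModule ℝ E]

theorem posSupNorm_smul {c : ℝ} (hc : 0 < c) (z : E) :
    posSupNorm T (c • z) = c * posSupNorm T z := by
  have key : ∀ {c : ℝ}, 0 < c → ∀ z : E, posSupNorm T (c • z) ≤ c * posSupNorm T z := by
    intro c hc z
    refine posSupNorm_le fun x hx => ?_
    have h : |c⁻¹ • x| ≤ z⁺ := by
      have h₁ : |x| ≤ c • z⁺ := hx.trans <|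
        sup_le (smul_le_smul_of_nonneg_left (le_posPart z) hc.le)
          (smul_nonneg hc.le (posPart_nonneg z))
      obtain ⟨h₂, h₃⟩ := abs_le'.1 h₁
      refine abs_le'.2 ⟨(inv_smul_le_iff_of_pos hc).2 h₂, ?_⟩
      rw [← smul_neg]
      exact (inv_smul_le_iff_of_pos hc).2 h₃
    have h₃ := norm_le_posSupNorm T h
    rw [map_smul, norm_smul, Real.norm_of_nonneg (inv_pos.2 hc).le] at h₃
    rwa [inv_mul_le_iff₀ hc] at h₃
  refine le_antisymm (key hc z) ?_
  have h := key (inv_pos.2 hc) (c • z)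
  rw [inv_smul_smul₀ hc.ne'] at h
  rwa [← le_inv_mul_iff₀ hc]

/-- Hahn-Banach: `posSupNorm T` is attained at `y` by a continuous functional it dominates. -/
theorem exists_dual_le_posSupNorm (y : E) :
    ∃ φ : StrongDual ℝ E, (∀ z, φ z ≤ posSupNorm T z) ∧ φ y = posSupNorm T y := by
  have p0 : posSupNorm T (0 : E) = 0 := posSupNorm_of_nonpos T le_rfl
  have H : ∀ c : ℝ, c • y = 0 → (RingHom.id ℝ c) • posSupNorm T y = 0 := by
    intro c hc
    rcases smul_eq_zero.1 hc with rfl | rfl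
    · simp
    · simp [p0]
  obtain ⟨g, hg, hgp⟩ := exists_extension_of_le_sublinear
    (LinearPMap.mkSpanSingleton' y (posSupNorm T y) H) (posSupNorm T)
    (fun c hc x => posSupNorm_smul T hc x) (posSupNorm_add_le T) (by
      rintro ⟨x, hx⟩
      obtain ⟨c, rfl⟩ := Submodule.mem_span_singleton.1 hx
      rw [LinearPMap.mkSpanSingleton'_apply]
      rcases le_or_gt c 0 with hc | hc
      · exact (mul_nonpos_of_nonpos_of_nonneg hc (posSupNorm_nonneg T y)).trans
          (posSupNorm_nonneg T _)
      · exact (posSupNorm_smul T hc y).ge)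
  refine ⟨g.mkContinuous ‖T‖ fun x => ?_, hgp, ?_⟩
  · refine abs_le'.2 ⟨(hgp x).trans (posSupNorm_le_opNorm_mul T x), ?_⟩
    have := (hgp (-x)).trans (posSupNorm_le_opNorm_mul T (-x))
    rwa [map_neg, norm_neg] at this
  · have hy : y ∈ (LinearPMap.mkSpanSingleton' y (posSupNorm T y) H).domain :=
      Submodule.mem_span_singleton_self y
    have h := hg ⟨y, hy⟩
    rw [LinearPMap.mkSpanSingleton'_apply_self] at h
    exact h

end LatticeSeminorm

section WeaklySummable

variable {E : Type*} [NormedAddCommGroup E] [NormedSpace ℝ E] [Lattice E]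

theorem uawTendsto_zero_iff {x : ℕ → E} :
    UAWTendsto x atTop 0 ↔ ∀ v : E, 0 ≤ v → ∀ f : StrongDual ℝ E,
      Tendsto (fun n => f (|x n| ⊓ v)) atTop (𝓝 0) := by
  simp only [UAWTendsto, sub_zero]
  refine forall₂_congr fun v _ => ?_
  have h := WeakBilin.tendsto_iff_forall_eval_tendsto (topDualPairing ℝ E).flip
    (l := atTop) (f := fun n => toWeakSpace ℝ E (|x n| ⊓ v)) (x := 0) (by
      intro a b hab
      refine (SeparatingDual.eq_iff_forall_dual_eq (R := ℝ)).2 fun g => ?_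
      exact DFunLike.congr_fun hab g)
  refine h.trans (forall_congr' fun f => ?_)
  change Tendsto _ _ (𝓝 (f 0)) ↔ _
  rw [map_zero]
  rfl

variable [IsOrderedAddMonoid E] [HasSolidNorm E]

/-- A continuous functional maps a positive sequence with order bounded partial sums to a null
sequence. -/
theorem tendsto_dual_apply_of_sum_le {a : ℕ → E} {u : E} (ha : ∀ n, 0 ≤ a n)
    (hu : ∀ n, ∑ i ∈ Finset.range n, a i ≤ u) (f : StrongDual ℝ E) :
    Tendsto (fun n => f (a n)) atTop (𝓝 0) := by
  refine (summable_of_sum_range_le (f := fun n => |f (a n)|) (c := ‖f‖ * ‖u‖)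
    (fun _ => abs_nonneg _) fun n => ?_).of_abs.tendsto_atTop_zero
  let s : ℕ → ℝ := fun i => if 0 ≤ f (a i) then 1 else -1
  have h₁ : ∑ i ∈ Finset.range n, |f (a i)| = f (∑ i ∈ Finset.range n, s i • a i) := by
    rw [map_sum]
    refine Finset.sum_congr rfl fun i _ => ?_
    by_cases h : 0 ≤ f (a i)
    · simp [s, h, abs_of_nonneg h]
    · simp [s, h, abs_of_neg (not_le.1 h)]
  have h₂ : ∀ n, |∑ i ∈ Finset.range n, s i • a i| ≤ ∑ i ∈ Finset.range n, a i := by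
    intro n
    induction n with
    | zero => simp
    | succ n ih =>
      rw [Finset.sum_range_succ, Finset.sum_range_succ]
      refine (abs_add_le _ _).trans (add_le_add ih ?_)
      by_cases h : 0 ≤ f (a n) <;> simp [s, h, abs_of_nonneg (ha n)]
  rw [h₁]
  refine (le_abs_self _).trans ((f.le_opNorm _).trans ?_)
  exact mul_le_mul_of_nonneg_left
    (norm_le_norm_of_abs_le_abs ((h₂ n).trans ((hu n).trans (le_abs_self u)))) (norm_nonneg f)

end WeaklySummable

section Equivalence

variable {E Y : Type*} [NormedAddCommGroup E] [NormedSpace ℝ E] [Lattice E]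
  [IsOrderedAddMonoid E] [HasSolidNorm E]
  [NormedAddCommGroup Y] [NormedSpace ℝ Y] {T : E →L[ℝ] Y} {u : E}

/-- Monotone sequences in `[0, u]` are Cauchy for the seminorm `posSupNorm T`. -/
theorem IsLWeaklyCompactOn.exists_posSupNorm_sub_le
    (hT : IsLWeaklyCompactOn T (Set.Icc (-u) u)) {w : ℕ → E} (hw : Monotone w)
    (h0 : ∀ n, 0 ≤ w n) (h1 : ∀ n, w n ≤ u) {δ : ℝ} (hδ : 0 < δ) :
    ∃ N, ∀ m, N ≤ m → posSupNorm T (w m - w N) ≤ δ := by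
  by_contra! H
  choose next hnext hlt using H
  have hu : 0 ≤ u := (h0 0).trans (h1 0)
  let N : ℕ → ℕ := fun j => next^[j] 0
  have hN : ∀ j, N (j + 1) = next (N j) := fun j => Function.iterate_succ_apply' _ _ _
  have hz : ∀ j, 0 ≤ w (N (j + 1)) - w (N j) := fun j =>
    sub_nonneg.2 (hw (by rw [hN]; exact hnext _))
  have hx : ∀ j, ∃ x, |x| ≤ w (N (j + 1)) - w (N j) ∧ δ < ‖T x‖ := fun j => by
    obtain ⟨x, hx, hδx⟩ := exists_lt_norm_of_lt_posSupNorm (hlt (N j))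
    rw [← hN, posPart_eq_self.2 (hz j)] at hx
    exact ⟨x, hx, hδx⟩
  choose x hx hxδ using hx
  have hsum : ∀ n, ∑ j ∈ Finset.range n, |x j| ≤ u := fun n => by
    refine (Finset.sum_le_sum fun j _ => hx j).trans ?_
    rw [Finset.sum_range_sub (fun j => w (N j))]
    exact (sub_le_self _ (h0 _)).trans (h1 _)
  have hlim : Tendsto (fun n => T (x n)) atTop (𝓝 0) := by
    refine hT x (fun n => ⟨u, ⟨neg_le_self hu, le_rfl⟩, ?_⟩) (uawTendsto_zero_iff.2 ?_)
    · rw [abs_of_nonneg hu]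
      exact (hx n).trans ((sub_le_self _ (h0 _)).trans (h1 _))
    · intro v hv f
      refine tendsto_dual_apply_of_sum_le (u := u) (fun n => le_inf (abs_nonneg _) hv)
        (fun n => ?_) f
      exact (Finset.sum_le_sum fun j _ => inf_le_left).trans (hsum n)
  obtain ⟨n, hn⟩ := (hlim.norm.eventually_lt_const (by simpa using hδ)).exists
  exact hn.not_gt (hxδ n)

theorem IsLWeaklyCompactOn.of_exists_dual_add_le (hu : 0 ≤ u)
    (H : ∀ ε : ℝ, 0 < ε → ∃ g : StrongDual ℝ E, ∀ x ∈ Set.Icc (-u) u, ‖T x‖ ≤ g |x| + ε) :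
    IsLWeaklyCompactOn T (Set.Icc (-u) u) := by
  intro x hx hx0
  have hxu : ∀ n, |x n| ≤ u := fun n => by
    obtain ⟨z, hz, hxz⟩ := hx n
    exact hxz.trans (abs_le'.2 ⟨hz.2, neg_le.1 hz.1⟩)
  refine tendsto_zero_iff_norm_tendsto_zero.2 (tendsto_order.2 ⟨fun a ha =>
    .of_forall fun n => ha.trans_le (norm_nonneg _), fun ε hε => ?_⟩)
  obtain ⟨g, hg⟩ := H (ε / 2) (half_pos hε)
  filter_upwards [(uawTendsto_zero_iff.1 hx0 u hu g).eventually_lt_const (half_pos hε)] with n hn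
  rw [inf_eq_left.2 (hxu n)] at hn
  obtain ⟨h₁, h₂⟩ := abs_le'.1 (hxu n)
  linarith [hg (x n) ⟨neg_le.1 h₂, h₁⟩]

variable [IsOrderedModule ℝ E]

/-- If no positive functional controls `T` on `[-u, u]` up to `ε`, there are functionals dominated
by `posSupNorm T` that exceed `ε` at points of `[0, u]` on which all the earlier functionals are
geometrically small. -/
theorem exists_seq_dual_of_forall_exists {ε : ℝ} (hε : 0 < ε)
    (H : ∀ g : StrongDual ℝ E, (∀ y : E, 0 ≤ y → 0 ≤ g y) →
      ∃ x ∈ Set.Icc (-u) u, g |x| + ε < ‖T x‖) :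
    ∃ (φ : ℕ → StrongDual ℝ E) (y : ℕ → E), (∀ n z, φ n z ≤ posSupNorm T z) ∧
      (∀ n, 0 ≤ y n) ∧ (∀ n, y n ≤ u) ∧ (∀ n, ε < φ n (y n)) ∧
      ∀ i n, i < n → 2 ^ n * φ i (y n) ≤ 2 ^ i * posSupNorm T u := by
  have step : ∀ g : {g : StrongDual ℝ E // ∀ y : E, 0 ≤ y → 0 ≤ g y},
      ∃ (ψ : StrongDual ℝ E) (a : E), (∀ z, ψ z ≤ posSupNorm T z) ∧ 0 ≤ a ∧ a ≤ u ∧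
        g.1 a + ε < ψ a := by
    rintro ⟨g, hg⟩
    obtain ⟨x, hx, hlt⟩ := H g hg
    obtain ⟨ψ, hψ, hψx⟩ := exists_dual_le_posSupNorm T |x|
    refine ⟨ψ, |x|, hψ, abs_nonneg x, abs_le'.2 ⟨hx.2, neg_le.1 hx.1⟩, ?_⟩
    rw [hψx]
    exact hlt.trans_le (norm_le_posSupNorm T (le_posPart |x|))
  choose ψ a hψ ha0 hau hlt using step
  let G : ℕ → {g : StrongDual ℝ E // ∀ y : E, 0 ≤ y → 0 ≤ g y} := fun n =>
    Nat.rec ⟨0, fun _ _ => le_rfl⟩ (fun _ g => ⟨(2 : ℝ) • (g.1 + ψ g), fun y hy =>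
      mul_nonneg zero_le_two (add_nonneg (g.2 y hy) (nonneg_of_le_posSupNorm T (hψ g) hy))⟩) n
  have hG : ∀ n y, (G (n + 1)).1 y = 2 * ((G n).1 y + ψ (G n) y) := fun n y => rfl
  have hψ0 : ∀ n y, 0 ≤ y → 0 ≤ ψ (G n) y := fun n y hy =>
    nonneg_of_le_posSupNorm T (hψ (G n)) hy
  refine ⟨fun n => ψ (G n), fun n => a (G n), fun n => hψ (G n), fun n => ha0 (G n),
    fun n => hau (G n), fun n => ?_, fun i n hin => ?_⟩
  · linarith [hlt (G n), (G n).2 _ (ha0 (G n))]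
  · have hdom : ∀ n, i < n → ∀ y, 0 ≤ y → 2 ^ n * ψ (G i) y ≤ 2 ^ i * (G n).1 y := by
      intro n hn y hy
      induction n, hn using Nat.le_induction with
      | base =>
        rw [hG, pow_succ]
        have : (0 : ℝ) ≤ 2 ^ i * 2 * (G i).1 y := mul_nonneg (by positivity) ((G i).2 y hy)
        linarith
      | succ n _ ih =>
        rw [hG, pow_succ]
        have : (0 : ℝ) ≤ 2 ^ i * ψ (G n) y := mul_nonneg (by positivity) (hψ0 n y hy)
        linarith
    refine (hdom n hin _ (ha0 (G n))).trans (mul_le_mul_of_nonneg_left ?_ (by positivity))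
    have h := (hψ (G n) (a (G n))).trans (posSupNorm_mono T (hau (G n)))
    linarith [hlt (G n)]

/-- Under L-weak compactness on `[-u, u]`, a positive functional controls `T` up to `ε`. -/
theorem IsLWeaklyCompactOn.exists_dual_add_le
    (hT : IsLWeaklyCompactOn T (Set.Icc (-u) u)) {ε : ℝ} (hε : 0 < ε) :
    ∃ g : StrongDual ℝ E, (∀ y : E, 0 ≤ y → 0 ≤ g y) ∧
      ∀ x ∈ Set.Icc (-u) u, ‖T x‖ ≤ g |x| + ε := by
  by_contra! H
  obtain ⟨φ, y, hφ, hy0, hyu, hφy, hsmall⟩ := exists_seq_dual_of_forall_exists hε H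
  have hφ0 : ∀ n {z : E}, 0 ≤ z → 0 ≤ φ n z := fun n _ => nonneg_of_le_posSupNorm T (hφ n)
  set R := posSupNorm T u
  have hR : 0 ≤ R := posSupNorm_nonneg T u
  let w : ℕ → ℕ → E := fun n k => partialSups (fun j => y (n + j)) k
  have hw_le : ∀ n k, w n k ≤ u := fun n k => partialSups_le _ _ _ fun j _ => hyu _
  have hy_le : ∀ {n j k}, j ≤ k → y (n + j) ≤ w n k := fun {n j k} hjk =>
    le_partialSups_of_le (fun j => y (n + j)) hjk
  have hw0 : ∀ n k, 0 ≤ w n k := fun n k => (hy0 _).trans (hy_le k.zero_le)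
  have hφw : ∀ i n k, i < n →
      2 ^ (n + k) * φ i (w n k) ≤ 2 ^ i * R * (2 * 2 ^ k - 1) := by
    intro i n k hin
    induction k with
    | zero =>
      have : w n 0 = y n := partialSups_zero _
      rw [this]
      simpa [show (2 : ℝ) - 1 = 1 by norm_num] using hsmall i n hin
    | succ k ih =>
      have h₁ : w n (k + 1) ≤ w n k + y (n + (k + 1)) := by
        change partialSups _ (k + 1) ≤ _
        rw [partialSups_add_one]
        exact sup_le (le_add_of_nonneg_right (hy0 _)) (le_add_of_nonneg_left (hw0 n k))
      have h₂ := hφ0 i (sub_nonneg.2 h₁)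
      rw [map_sub, map_add] at h₂
      have h₃ := hsmall i (n + (k + 1)) (by omega)
      have h₄ : (2 : ℝ) ^ (n + (k + 1)) * φ i (w n (k + 1)) ≤
          2 ^ (n + (k + 1)) * (φ i (w n k) + φ i (y (n + (k + 1)))) :=
        mul_le_mul_of_nonneg_left (by linarith) (by positivity)
      have h₅ : (2 : ℝ) ^ (n + (k + 1)) = 2 * 2 ^ (n + k) := by ring
      have h₆ : (2 : ℝ) ^ (k + 1) = 2 * 2 ^ k := by ring
      rw [h₆]
      rw [mul_add, h₅, mul_assoc 2] at h₄
      rw [h₅] at h₃ ⊢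
      linarith
  have hφw' : ∀ i n k, i < n → 2 ^ n * φ i (w n k) ≤ 2 * (2 ^ i * R) := by
    intro i n k hin
    have h := hφw i n k hin
    have h₁ : (0 : ℝ) ≤ 2 ^ i * R := by positivity
    refine le_of_mul_le_mul_left ?_ (pow_pos (zero_lt_two' ℝ) k)
    rw [pow_add] at h
    linarith
  have hcauchy : ∀ n, ∃ N, ∀ m, N ≤ m → posSupNorm T (w n m - w n N) ≤ ε / 4 * (1 / 2) ^ n :=
    fun n => hT.exists_posSupNorm_sub_le (partialSups_monotone _) (hw0 n) (hw_le n)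
      (by positivity)
  choose N hN using hcauchy
  let v : ℕ → E := fun n => w n (N n)
  let s : ℕ → E := fun n => partialSups (fun k => u - v k) n
  have hvs : ∀ n, u - s n ≤ v n := fun n =>
    sub_le_comm.1 (le_partialSups (fun k => u - v k) n)
  have hs0 : ∀ n, 0 ≤ s n := fun n =>
    (sub_nonneg.2 (hw_le n (N n))).trans (le_partialSups (fun k => u - v k) n)
  have hsu : ∀ n, s n ≤ u := fun n =>
    partialSups_le _ _ _ fun j _ => sub_le_self u (hw0 j (N j))
  have hyv : ∀ n k, k ≤ n → posSupNorm T (y n - v k) ≤ ε / 4 * (1 / 2) ^ k := by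
    intro n k hkn
    refine (posSupNorm_mono T (sub_le_sub_right ?_ (v k))).trans
      (hN k (max (n - k) (N k)) (le_max_right _ _))
    have h := hy_le (n := k) (le_max_left (n - k) (N k))
    rwa [Nat.add_sub_cancel' hkn] at h
  have hys : ∀ n k, k ≤ n →
      posSupNorm T (y n - (u - s k)) ≤ ε / 4 * (2 - (1 / 2) ^ k) := by
    intro n k hkn
    induction k with
    | zero =>
      have : u - s 0 = v 0 := by simp [s]
      rw [this]
      exact (hyv n 0 hkn).trans_eq (by ring)
    | succ k ih =>
      have h₁ : y n - (u - s (k + 1)) = (y n - (u - s k)) ⊔ (y n - v (k + 1)) := by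
        have : s (k + 1) = s k ⊔ (u - v (k + 1)) := partialSups_add_one _ _
        have aux : ∀ t, y n - (u - t) = (y n - u) + t := fun t => by abel
        rw [this, aux, aux, add_sup, sub_add_sub_cancel]
      rw [h₁]
      refine (posSupNorm_sup_le T _ _).trans
        ((add_le_add (ih (by omega)) (hyv n (k + 1) hkn)).trans_eq (by ring))
  obtain ⟨n, hn⟩ := hT.exists_posSupNorm_sub_le (partialSups_monotone _) hs0 hsu
    (show 0 < ε / 4 by positivity)
  have hlow : ∀ m, n < m → ε / 4 < φ n (v m) := by
    intro m hm
    have h₁ := (hφ n _).trans (hys n n le_rfl)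
    have h₂ := (hφ n _).trans (hn m hm.le)
    have h₃ := hφ0 n (sub_nonneg.2 (hvs m))
    have h₄ : (0 : ℝ) < ε / 4 * (1 / 2) ^ n := by positivity
    change φ n (s m - s n) ≤ _ at h₂
    simp only [map_sub] at h₁ h₂ h₃
    linarith [hφy n]
  have hlim : Tendsto (fun m => 2 * (2 ^ n * R) * (1 / 2 : ℝ) ^ m) atTop (𝓝 0) := by
    simpa using (tendsto_pow_atTop_nhds_zero_of_lt_one (r := (1 / 2 : ℝ))
      (by norm_num) (by norm_num)).const_mul (2 * (2 ^ n * R))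
  obtain ⟨m, hm, hnm⟩ := ((hlim.eventually_lt_const (show 0 < ε / 4 by positivity)).and
    (eventually_gt_atTop n)).exists
  have h₁ := hφw' n m (N m) hnm
  have h₂ : φ n (v m) ≤ 2 * (2 ^ n * R) * (1 / 2) ^ m := by
    rw [one_div, inv_pow, ← div_eq_mul_inv, le_div_iff₀ (by positivity), mul_comm]
    exact h₁
  linarith [hlow m hnm]

end Equivalence

theorem theorem3p3 {E Y : Type*}
    [NormedAddCommGroup E] [NormedSpace ℝ E] [CompleteSpace E]
    [Lattice E] [IsOrderedAddMonoid E] [IsOrderedModule ℝ E] [HasSolidNorm E]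
    [NormedAddCommGroup Y] [NormedSpace ℝ Y] [CompleteSpace Y]
    (T : E →L[ℝ] Y) (u : E) (hu : 0 ≤ u) :
    IsLWeaklyCompactOn T (Set.Icc (-u) u) ↔
      ∀ ε : ℝ, 0 < ε → ∃ g : StrongDual ℝ E, (∀ y : E, 0 ≤ y → 0 ≤ g y) ∧
        ∀ x ∈ Set.Icc (-u) u, ‖T x‖ ≤ g |x| + ε :=
  ⟨fun hT _ hε => hT.exists_dual_add_le hε, fun H => .of_exists_dual_add_le hu fun ε hε =>
    (H ε hε).imp fun _ hg => hg.2⟩
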